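/- Let $G=(V,E)$ be a finite, nonempty, strongly connected digraph without sinks; loops and multiple edges are allowed. Write $\deg^+(v)$ for the number of edges with tail $v$. An oriented spanning tree of $G$ rooted at $s$ is a spanning subgraph in which $s$ has outdegree $0$ and in which every vertex $v$ has exactly one directed walk to $s$ (the empty walk if $v=s$). Let $\mathcal T(s)$ be the number of oriented spanning trees rooted at $s$, and let $M=\gcd\{\mathcal T(v): v\in V\}$. For each vertex fix a cyclic ordering of the edges emanating from it, and let $e^+$ be the edge after $e$. A state is a pair $(v,\rho)$, where $v\in V$ is the location of the chip and $\rho$ assigns to every vertex $u$ an edge $\rho(u)$ emanating from $u$. The rotor-router operation replaces $\rho(v)$ by $\rho(v)^+$ and then moves the chip from $v$ to the head of the updated edge $\rho(v)$. A state is recurrent if iterating the operation a positive number of times leads back to it; its orbit is the set of all states reachable from it by iterating the operation. The rotor walk $(v_i)_{i\ge 0}$ from a state is the sequence of consecutive locations of the chip. Then: (1) For every recurrent state $c$ and every $v\in V$, the number of states in the orbit of $c$ in which the chip is at $v$ is exactly $\frac{1}{M}\,\mathcal T(v)\deg^+(v)$. (2) For every initial state (recurrent or not) and every $v\in V$, the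 rotor walk satisfies $$\lim_{t\to\infty}\frac1t\sum_{0\le i\le t-1}\mathbf 1_{\{v_i=v\}}=\frac{\mathcal T(v)\deg^+(v)}{\sum_{w\in V}\mathcal T(w)\deg^+(w)}.$$ (3) The simple random walk on $G$, with transition probabilities $P(u,w)=\#\{e\in E: e\text{ goes from }u\text{ to }w\}/\deg^+(u)$, has exactly one stationary distribution $\pi$ (a probability vector with $\pi P=\pi$), and $\pi(v)=\mathcal T(v)\deg^+(v)/\sum_{w\in V}\mathcal T(w)\deg^+(w)$ for every $v\in V$. -/

import Mathlib

open Filter Topology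

/-- A digraph with vertex type `V` and edge type `E`; loops and multiple edges are allowed.
The edge `e` goes from `tail e` to `head e`. -/
structure MultiDigraph (V E : Type*) where
  tail : E → V
  head : E → V

namespace MultiDigraph

/-- `G.IsWalk u l w`: the edges in the list `l`, in this order, form a directed walk
from `u` to `w` in `G`. The empty list is a walk from each vertex to itself. -/
def IsWalk {V E : Type*} (G : MultiDigraph V E) : V → List E → V → Prop
  | u, [], w => u = w
  | u, e :: l, w => G.tail e = u ∧ G.IsWalk (G.head e) l w

/-- From every vertex there is a directed walk to every vertex. -/
def StronglyConnected {V E : Type*} (G : MultiDigraph V E) : Prop :=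
  ∀ u w : V, ∃ l : List E, G.IsWalk u l w

/-- The outdegree of `v`: the number of edges with tail `v` (a loop counts once). -/
def outDegree {V E : Type*} [Fintype E] [DecidableEq V] (G : MultiDigraph V E) (v : V) : ℕ :=
  (Finset.univ.filter fun e : E => G.tail e = v).card

/-- The number of edges from `u` to `w`. -/
def numEdges {V E : Type*} [Fintype E] [DecidableEq V] (G : MultiDigraph V E) (u w : V) : ℕ :=
  (Finset.univ.filter fun e : E => G.tail e = u ∧ G.head e = w).card

/-- A sink is a vertex of outdegree `0`. -/
def IsSink {V E : Type*} [Fintype E] [DecidableEq V] (G : MultiDigraph V E) (v : V) : Prop :=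
  G.outDegree v = 0

/-- The spanning subgraph with edge set `T` is an oriented spanning tree rooted at `s`:
the root has outdegree `0` in it, and from every vertex `v` there is exactly one directed walk
to `s` in it (such a unique walk repeats no vertex, so it is a path). Equivalently, every vertex
other than `s` has outdegree `1` in it, `s` has outdegree `0`, and there is no directed cycle. -/
def IsOrientedSpanningTree {V E : Type*} (G : MultiDigraph V E) (s : V) (T : Finset E) : Prop :=
  (∀ e ∈ T, G.tail e ≠ s) ∧
    ∀ v : V, ∃! l : List E, G.IsWalk v l s ∧ ∀ e ∈ l, e ∈ T

/-- The number of oriented spanning trees of `G` rooted at `s`. -/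
noncomputable def numSpanningTrees {V E : Type*} (G : MultiDigraph V E) (s : V) : ℕ :=
  Set.ncard {T : Finset E | G.IsOrientedSpanningTree s T}

/-- The greatest common divisor of the numbers of oriented spanning trees over all roots. -/
noncomputable def treeGcd {V E : Type*} [Fintype V] (G : MultiDigraph V E) : ℕ :=
  Finset.univ.gcd fun v : V => G.numSpanningTrees v

/-- A choice, for every vertex, of a cyclic ordering of the edges emanating from it:
`next e` is the edge after `e`, it has the same tail as `e`, and iterating `next` runs through
all the edges with that tail. -/
structure CyclicOrdering {V E : Type*} (G : MultiDigraph V E) where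
  next : Equiv.Perm E
  tail_next : ∀ e : E, G.tail (next e) = G.tail e
  sameCycle : ∀ e f : E, G.tail e = G.tail f → next.SameCycle e f

/-- A rotor configuration of a digraph without sinks: every vertex is assigned an edge
emanating from it. -/
structure RotorConfig {V E : Type*} (G : MultiDigraph V E) where
  edge : V → E
  tail_edge : ∀ v : V, G.tail (edge v) = v

/-- A single-chip-and-rotor state: the location of the chip and a rotor configuration. -/
abbrev State {V E : Type*} (G : MultiDigraph V E) := V × G.RotorConfig

/-- Turning the rotor at `v` to the next edge in the cyclic ordering. -/
def turn {V E : Type*} [DecidableEq V] {G : MultiDigraph V E} (C : G.CyclicOrdering)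
    (ρ : G.RotorConfig) (v : V) : G.RotorConfig where
  edge := Function.update ρ.edge v (C.next (ρ.edge v))
  tail_edge := by
    intro u
    by_cases h : u = v
    · subst h
      rw [Function.update_self, C.tail_next, ρ.tail_edge]
    · rw [Function.update_of_ne h, ρ.tail_edge]

/-- The rotor-router operation: the rotor at the location of the chip is turned, and then the
chip moves along the updated rotor to its head. -/
def rotorRouter {V E : Type*} [DecidableEq V] {G : MultiDigraph V E} (C : G.CyclicOrdering)
    (c : G.State) : G.State :=
  (G.head ((turn C c.2 c.1).edge c.1), turn C c.2 c.1)

/-- The rotor walk started from the state `c`: the consecutive locations of the chip. -/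
def rotorWalk {V E : Type*} [DecidableEq V] {G : MultiDigraph V E} (C : G.CyclicOrdering)
    (c : G.State) (i : ℕ) : V :=
  ((rotorRouter C)^[i] c).1

/-- A state is recurrent if it is reached again after a positive number of steps. -/
def IsRecurrent {V E : Type*} [DecidableEq V] {G : MultiDigraph V E} (C : G.CyclicOrdering)
    (c : G.State) : Prop :=
  ∃ n : ℕ, 0 < n ∧ (rotorRouter C)^[n] c = c

/-- The set of the states that are reachable from `c` by iterating the rotor-router operation. -/
def orbit {V E : Type*} [DecidableEq V] {G : MultiDigraph V E} (C : G.CyclicOrdering)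
    (c : G.State) : Set G.State :=
  {d | ∃ n : ℕ, (rotorRouter C)^[n] c = d}

/-- The transition matrix of the simple random walk on a digraph without sinks: from `u` the
walker follows an edge chosen uniformly among the edges emanating from `u`. -/
noncomputable def transitionMatrix {V E : Type*} [Fintype E] [DecidableEq V]
    (G : MultiDigraph V E) : Matrix V V ℝ :=
  Matrix.of fun u w => (G.numEdges u w : ℝ) / (G.outDegree u : ℝ)

/-- `π` is a stationary distribution of the simple random walk on `G`: a probability vector
with `π P = π` for the transition matrix `P`. -/
def IsStationaryDistribution {V E : Type*} [Fintype V] [Fintype E] [DecidableEq V]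
    (G : MultiDigraph V E) (π : V → ℝ) : Prop :=
  π ∈ stdSimplex ℝ V ∧ Matrix.vecMul π G.transitionMatrix = π

/-- The vector with entries `T(v) deg⁺(v) / ∑ w, T(w) deg⁺(w)`, where `T(v)` is the number of
oriented spanning trees rooted at `v`. -/
noncomputable def treeFrequency {V E : Type*} [Fintype V] [Fintype E] [DecidableEq V]
    (G : MultiDigraph V E) (v : V) : ℝ :=
  ((G.numSpanningTrees v : ℝ) * (G.outDegree v : ℝ)) /
    ∑ w : V, (G.numSpanningTrees w : ℝ) * (G.outDegree w : ℝ)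

end MultiDigraph

/-! Everything rests on the left kernel of the Laplacian, the balanced vectors. By strong
connectivity and a minimum principle it is a line (`Balanced.exists_eq_smul`), and it contains the
tree counts: configurations whose rotors all lead to `u` number `T(u) deg⁺(u)` by the rotor at `u`,
and the sum of `T(tail f)` over edges `f` into `u` by the rotor that enters `u` on the cycle
(`balanced_numSpanningTrees`).

During a period of a recurrent state each rotor makes `k v` full turns, and conservation of the chip
makes `k` balanced, so `k` is proportional to `T` (`exists_balanced_of_iterate_eq`). Recurrence also
forces all rotors to lead to the chip, and from such a state any balanced vector of full turns
brings the state back (`iterate_eq_of_balanced`). Hence a common factor of `k` would shorten the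
minimal period, so `gcd k = 1` and `k = T / M`.

Every walk becomes periodic by finiteness, which gives the limit. For (3), `π` is stationary iff `π
/ deg⁺` is balanced. -/

namespace MultiDigraph

variable {V E : Type*}

/-! ### The kernel of the Laplacian -/

section Balanced

variable [DecidableEq V] [Fintype E] {G : MultiDigraph V E}

/-- A vector `y` in the left kernel of the Laplacian: if every edge `e` carries `y (tail e)` units,
then every vertex receives as much as it sends out. -/
def Balanced (G : MultiDigraph V E) (y : V → ℝ) : Prop :=
  ∀ u, ∑ f with G.head f = u, y (G.tail f) = y u * G.outDegree u

theorem Balanced.sub_smul {y z : V → ℝ} (hy : G.Balanced y) (hz : G.Balanced z) (a : ℝ) :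
    G.Balanced fun v => y v - a * z v := by
  intro u
  rw [Finset.sum_sub_distrib, ← Finset.mul_sum, hy u, hz u]
  ring

/-- A zero propagates backwards along edges: the inflow there is a vanishing sum of nonnegative
terms. -/
theorem Balanced.eq_zero (hG : G.StronglyConnected) {z : V → ℝ} (hz : G.Balanced z)
    (hnonneg : ∀ v, 0 ≤ z v) {v : V} (hv : z v = 0) (u : V) : z u = 0 := by
  obtain ⟨l, hl⟩ := hG u v
  induction l generalizing u with
  | nil => rw [show u = v from hl, hv]
  | cons e l ih =>
    obtain ⟨rfl, h2⟩ := hl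
    have h := hz (G.head e)
    rw [ih _ h2, zero_mul, Finset.sum_eq_zero_iff_of_nonneg fun f _ => hnonneg _] at h
    exact h e (by simp)

theorem Balanced.pos (hG : G.StronglyConnected) {z : V → ℝ} (hz : G.Balanced z)
    (hnonneg : ∀ v, 0 ≤ z v) {v : V} (hv : 0 < z v) (u : V) : 0 < z u :=
  (hnonneg u).lt_of_ne fun h => hv.ne' (hz.eq_zero hG hnonneg h.symm v)

theorem Balanced.exists_eq_smul [Fintype V] [Nonempty V] (hG : G.StronglyConnected) {y z : V → ℝ}
    (hy : G.Balanced y) (hz : G.Balanced z) (hpos : ∀ v, 0 < z v) : ∃ a, ∀ v, y v = a * z v := by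
  -- Subtracting the least ratio times `z` leaves a nonnegative balanced vector with a zero.
  obtain ⟨v, -, hv⟩ := Finset.exists_min_image Finset.univ (fun v => y v / z v)
    Finset.univ_nonempty
  refine ⟨y v / z v, fun u => sub_eq_zero.1 ?_⟩
  refine (hy.sub_smul hz (y v / z v)).eq_zero hG (fun w => ?_) (v := v) ?_ u
  · have := hv w (Finset.mem_univ _)
    rw [le_div_iff₀ (hpos w)] at this
    linarith
  · rw [div_mul_cancel₀ _ (hpos v).ne', sub_self]

end Balanced

/-! ### Spanning trees and rotor configurations -/

section Trees

variable {G : MultiDigraph V E}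

theorem RotorConfig.edge_injective :
    Function.Injective (RotorConfig.edge : G.RotorConfig → V → E) := by
  rintro ⟨a, _⟩ ⟨b, _⟩ h
  cases h
  rfl

instance [Finite V] [Finite E] : Finite G.RotorConfig :=
  Finite.of_injective _ RotorConfig.edge_injective

/-- The vertex that the rotor at `u` points to. -/
def RotorConfig.succ (ρ : G.RotorConfig) (u : V) : V := G.head (ρ.edge u)

/-- From every vertex, following the rotors leads to `v`. -/
def RotorConfig.LeadsTo (ρ : G.RotorConfig) (v : V) : Prop := ∀ u, ∃ n, ρ.succ^[n] u = v

theorem RotorConfig.LeadsTo.succ {ρ : G.RotorConfig} {v : V} (h : ρ.LeadsTo v) :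
    ρ.LeadsTo (ρ.succ v) := fun u => by
  obtain ⟨n, hn⟩ := h u
  exact ⟨n + 1, by rw [Function.iterate_succ_apply', hn]⟩

/-- `v` lies on the only cycle of `ρ.succ`, and `w` is its predecessor there; uniqueness is
injectivity on periodic points. -/
theorem RotorConfig.LeadsTo.existsUnique_pred {ρ : G.RotorConfig} {v : V} (h : ρ.LeadsTo v) :
    ∃! w, ρ.succ w = v ∧ ρ.LeadsTo w := by
  obtain ⟨n, hn⟩ := h (ρ.succ v)
  refine ⟨ρ.succ^[n] v, ⟨?_, fun u => ?_⟩, ?_⟩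
  · rw [← Function.iterate_succ_apply' ρ.succ, Function.iterate_succ_apply, hn]
  · obtain ⟨m, hm⟩ := h u
    exact ⟨n + m, by rw [Function.iterate_add_apply, hm]⟩
  · have hper : ∀ w, ρ.LeadsTo w → w ∈ Function.periodicPts ρ.succ := fun w hw => by
      obtain ⟨m, hm⟩ := hw (ρ.succ w)
      exact ⟨m + 1, m.succ_pos, hm⟩
    rintro w ⟨hw, hw'⟩
    refine (Function.bijOn_periodicPts ρ.succ).injOn (hper w hw') (hper _ fun u => ?_) ?_
    · obtain ⟨m, hm⟩ := h u
      exact ⟨n + m, by rw [Function.iterate_add_apply, hm]⟩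
    · rw [hw, ← Function.iterate_succ_apply' ρ.succ, Function.iterate_succ_apply, hn]

/-- Two such edges would start two different walks to the root. -/
theorem IsOrientedSpanningTree.eq_of_tail_eq {s : V} {T : Finset E}
    (hT : G.IsOrientedSpanningTree s T) {e f : E} (he : e ∈ T) (hf : f ∈ T)
    (h : G.tail e = G.tail f) : e = f := by
  obtain ⟨l, ⟨hl, hlT⟩, -⟩ := hT.2 (G.head e)
  obtain ⟨m, ⟨hm, hmT⟩, -⟩ := hT.2 (G.head f)
  have := (hT.2 (G.tail f)).unique (y₁ := e :: l) (y₂ := f :: m)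
    ⟨⟨h, hl⟩, by simpa [he] using hlT⟩ ⟨⟨rfl, hm⟩, by simpa [hf] using hmT⟩
  exact (List.cons.inj this).1

theorem IsOrientedSpanningTree.exists_tail_eq {s : V} {T : Finset E}
    (hT : G.IsOrientedSpanningTree s T) {v : V} (hv : v ≠ s) : ∃ e ∈ T, G.tail e = v := by
  obtain ⟨l, ⟨hl, hlT⟩, -⟩ := hT.2 v
  cases l with
  | nil => exact absurd hl hv
  | cons e l => exact ⟨e, hlT e (by simp), hl.1⟩

variable [Fintype V] [DecidableEq V]

open Classical in
/-- The set of the rotors at the vertices other than `s`. -/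
noncomputable def RotorConfig.edgesOff (ρ : G.RotorConfig) (s : V) : Finset E :=
  (Finset.univ.erase s).image ρ.edge

theorem RotorConfig.mem_edgesOff {ρ : G.RotorConfig} {s : V} {e : E} :
    e ∈ ρ.edgesOff s ↔ G.tail e ≠ s ∧ ρ.edge (G.tail e) = e := by
  simp only [edgesOff, Finset.mem_image, Finset.mem_erase, Finset.mem_univ, and_true]
  constructor
  · rintro ⟨v, hv, rfl⟩
    rw [ρ.tail_edge]
    exact ⟨hv, rfl⟩
  · exact fun h => ⟨_, h⟩

theorem RotorConfig.LeadsTo.isOrientedSpanningTree {ρ : G.RotorConfig} {s : V}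
    (h : ρ.LeadsTo s) : G.IsOrientedSpanningTree s (ρ.edgesOff s) := by
  refine ⟨fun e he => (mem_edgesOff.1 he).1, fun v => existsUnique_of_exists_of_unique ?_ ?_⟩
  · obtain ⟨n, hn⟩ := h v
    induction n generalizing v with
    | zero => exact ⟨[], hn, by simp⟩
    | succ n ih =>
      by_cases hv : v = s
      · exact ⟨[], hv, by simp⟩
      · obtain ⟨l, hl, hlT⟩ := ih (ρ.succ v) hn
        refine ⟨ρ.edge v :: l, ⟨ρ.tail_edge v, hl⟩, ?_⟩
        simp only [List.mem_cons, forall_eq_or_imp, mem_edgesOff, ρ.tail_edge]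
        exact ⟨⟨hv, trivial⟩, fun e he => mem_edgesOff.1 (hlT e he)⟩
  · rintro l m ⟨hl, hlT⟩ ⟨hm, hmT⟩
    induction l generalizing v m with
    | nil =>
      cases m with
      | nil => rfl
      | cons f m => exact absurd (hm.1.trans hl) (mem_edgesOff.1 (hmT f (by simp))).1
    | cons e l ih =>
      cases m with
      | nil => exact absurd (hl.1.trans hm) (mem_edgesOff.1 (hlT e (by simp))).1
      | cons f m =>
        have he := (mem_edgesOff.1 (hlT e (by simp))).2
        have hf := (mem_edgesOff.1 (hmT f (by simp))).2
        rw [hl.1] at he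
        rw [hm.1] at hf
        obtain rfl : e = f := he.symm.trans hf
        rw [ih _ m hl.2 (fun e he => hlT e (by simp [he])) hm.2 fun e he => hmT e (by simp [he])]

theorem IsOrientedSpanningTree.exists_rotorConfig {e : E} {T : Finset E}
    (hT : G.IsOrientedSpanningTree (G.tail e) T) :
    ∃ ρ : G.RotorConfig, (ρ.edge (G.tail e) = e ∧ ρ.LeadsTo (G.tail e)) ∧
      ρ.edgesOff (G.tail e) = T := by
  have h : ∀ v, ∃ f, G.tail f = v ∧ (v = G.tail e → f = e) ∧ (v ≠ G.tail e → f ∈ T) := by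
    intro v
    by_cases hv : v = G.tail e
    · exact ⟨e, hv.symm, fun _ => rfl, fun h => absurd hv h⟩
    · obtain ⟨f, hf, hfv⟩ := hT.exists_tail_eq hv
      exact ⟨f, hfv, fun h => absurd h hv, fun _ => hf⟩
  choose r hr hre hrT using h
  refine ⟨⟨r, hr⟩, ⟨hre _ rfl, fun u => ?_⟩, ?_⟩
  · obtain ⟨l, ⟨hl, hlT⟩, -⟩ := hT.2 u
    induction l generalizing u with
    | nil => exact ⟨0, hl⟩
    | cons f l ih =>
      obtain ⟨n, hn⟩ := ih _ hl.2 fun g hg => hlT g (by simp [hg])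
      have hf : f ∈ T := hlT f (by simp)
      have hu : u ≠ G.tail e := hl.1 ▸ hT.1 f hf
      have : r u = f := hT.eq_of_tail_eq (hrT u hu) hf ((hr u).trans hl.1.symm)
      refine ⟨n + 1, ?_⟩
      rw [Function.iterate_succ_apply]
      simpa only [RotorConfig.succ, this] using hn
  · ext f
    rw [RotorConfig.mem_edgesOff]
    constructor
    · rintro ⟨h1, h2⟩
      exact h2 ▸ hrT _ h1
    · exact fun hf => ⟨hT.1 f hf, hT.eq_of_tail_eq (hrT _ (hT.1 f hf)) hf (hr _)⟩

/-- Forgetting the rotor at the root, whose value `e` is prescribed, leaves a tree; adding `e` back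
is the inverse. -/
theorem ncard_rotorConfig_leadsTo_tail (e : E) :
    {ρ : G.RotorConfig | ρ.edge (G.tail e) = e ∧ ρ.LeadsTo (G.tail e)}.ncard =
      G.numSpanningTrees (G.tail e) := by
  refine Set.ncard_congr (fun ρ _ => ρ.edgesOff (G.tail e))
    (fun ρ hρ => hρ.2.isOrientedSpanningTree) ?_ ?_
  · rintro ρ σ ⟨hρ, -⟩ ⟨hσ, -⟩ h
    refine RotorConfig.edge_injective (funext fun v => ?_)
    by_cases hv : v = G.tail e
    · rw [hv, hρ, hσ]
    · have : ρ.edge v ∈ σ.edgesOff (G.tail e) := by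
        rw [← h, RotorConfig.mem_edgesOff, ρ.tail_edge]
        exact ⟨hv, rfl⟩
      rw [RotorConfig.mem_edgesOff, ρ.tail_edge] at this
      exact this.2.symm
  · intro T hT
    obtain ⟨ρ, hρ, h⟩ := IsOrientedSpanningTree.exists_rotorConfig hT
    exact ⟨ρ, hρ, h⟩

theorem sum_ncard_eq_ncard {α ι : Type*} [Finite α] (F : Finset ι) (S : ι → Set α)
    (Q : Set α) (hS : ∀ i ∈ F, S i ⊆ Q) (hQ : ∀ a ∈ Q, ∃! i, i ∈ F ∧ a ∈ S i) :
    ∑ i ∈ F, (S i).ncard = Q.ncard := by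
  classical
  have := Fintype.ofFinite α
  have h : Q.toFinset = F.biUnion fun i => (S i).toFinset := by
    ext a
    simp only [Set.mem_toFinset, Finset.mem_biUnion]
    exact ⟨fun ha => (hQ a ha).exists, fun ⟨i, hi, ha⟩ => hS i hi ha⟩
  rw [Set.ncard_eq_toFinset_card', h, Finset.card_biUnion]
  · simp only [Set.ncard_eq_toFinset_card']
  · intro i hi j hj hij
    refine Finset.disjoint_left.2 fun a ha hb => hij ?_
    rw [Set.mem_toFinset] at ha hb
    exact (hQ a (hS i hi ha)).unique ⟨hi, ha⟩ ⟨hj, hb⟩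

variable [Fintype E]

theorem ncard_rotorConfig_leadsTo (u : V) :
    {ρ : G.RotorConfig | ρ.LeadsTo u}.ncard = G.numSpanningTrees u * G.outDegree u := by
  rw [← sum_ncard_eq_ncard (Finset.univ.filter fun e => G.tail e = u)
    (fun e => {ρ : G.RotorConfig | ρ.edge (G.tail e) = e ∧ ρ.LeadsTo (G.tail e)})]
  · rw [Finset.sum_congr rfl (g := fun _ => G.numSpanningTrees u), Finset.sum_const,
      smul_eq_mul, mul_comm, outDegree]
    intro e he
    rw [ncard_rotorConfig_leadsTo_tail, (Finset.mem_filter.1 he).2]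
  · rintro e he ρ ⟨-, h⟩
    rwa [(Finset.mem_filter.1 he).2] at h
  · intro ρ hρ
    refine ⟨ρ.edge u, ⟨by simp [ρ.tail_edge], by rw [Set.mem_ofPred, ρ.tail_edge]; exact ⟨rfl, hρ⟩⟩,
      ?_⟩
    rintro e ⟨he, h, -⟩
    rw [(Finset.mem_filter.1 he).2] at h
    exact h.symm

/-- The Markov chain tree theorem: the vector of the numbers of oriented spanning trees lies in
the left kernel of the Laplacian. -/
theorem balanced_numSpanningTrees : G.Balanced fun v => (G.numSpanningTrees v : ℝ) := by
  intro u
  rw [← Nat.cast_mul, ← ncard_rotorConfig_leadsTo, ← Nat.cast_sum, Nat.cast_inj]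
  simp only [← ncard_rotorConfig_leadsTo_tail]
  refine sum_ncard_eq_ncard _ _ _ ?_ ?_
  · rintro e he ρ ⟨h, h'⟩
    have := h'.succ
    rwa [RotorConfig.succ, h, (Finset.mem_filter.1 he).2] at this
  · intro ρ hρ
    -- Moving the root from `u` back to its predecessor on the cycle assigns `ρ` to exactly one edge
    -- into `u`.
    obtain ⟨w, ⟨hw, hwl⟩, huniq⟩ := hρ.existsUnique_pred
    refine ⟨ρ.edge w, ⟨by simpa [RotorConfig.succ] using hw, ?_⟩, ?_⟩
    · rw [Set.mem_ofPred, ρ.tail_edge]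
      exact ⟨rfl, hwl⟩
    · rintro f ⟨hf, h, h'⟩
      rw [← huniq (G.tail f) ⟨by rw [RotorConfig.succ, h]; exact (Finset.mem_filter.1 hf).2, h'⟩, h]

end Trees

variable {G : MultiDigraph V E}

/-! ### Counting turns of a single rotor -/

section Cyclic

namespace CyclicOrdering

open Classical in
/-- The number of times that the rotor hits `f` during `n` turns starting from `e`. -/
noncomputable def hits (C : G.CyclicOrdering) (e f : E) (n : ℕ) : ℕ :=
  Nat.count (fun j => C.next^[j + 1] e = f) n

theorem hits_mono (C : G.CyclicOrdering) (e f : E) : Monotone (C.hits e f) := by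
  classical exact Nat.count_monotone _

variable [DecidableEq V] [Fintype E]

theorem isCycleOn (C : G.CyclicOrdering) (v : V) :
    C.next.IsCycleOn ((Finset.univ.filter fun e => G.tail e = v : Finset E) : Set E) := by
  refine ⟨⟨fun e he => ?_, C.next.injective.injOn, fun e he => ?_⟩, fun e he f hf => ?_⟩
  · simpa [C.tail_next] using he
  · refine ⟨C.next.symm e, ?_, by simp⟩
    have := C.tail_next (C.next.symm e)
    simp_all
  · exact C.sameCycle e f (by simp_all)

theorem iterate_next_eq_self_iff (C : G.CyclicOrdering) (e : E) (n : ℕ) :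
    C.next^[n] e = e ↔ G.outDegree (G.tail e) ∣ n := by
  rw [← Equiv.Perm.coe_pow]
  exact (C.isCycleOn (G.tail e)).pow_apply_eq (by simp)

theorem hits_mul_outDegree (C : G.CyclicOrdering) {e f : E} (h : G.tail e = G.tail f) (q : ℕ) :
    C.hits e f (q * G.outDegree (G.tail e)) = q := by
  classical
  induction q with
  | zero => simp [hits]
  | succ q ih =>
    rw [Nat.succ_mul, hits, Nat.count_add]
    rw [hits] at ih
    rw [ih]
    congr 1
    obtain ⟨n, hn, hnf⟩ := (C.isCycleOn (G.tail e)).exists_pow_eq (a := C.next e) (b := f)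
      (by simp [C.tail_next]) (by simp [h])
    have key : ∀ k, C.next^[q * G.outDegree (G.tail e) + k + 1] e = C.next^[k] (C.next e) := by
      intro k
      rw [show q * G.outDegree (G.tail e) + k + 1 = k + 1 + q * G.outDegree (G.tail e) by ring,
        Function.iterate_add_apply, (C.iterate_next_eq_self_iff e _).2 (Dvd.intro_left _ rfl),
        Function.iterate_succ_apply]
    simp only [key]
    rw [Nat.count_eq_card_filter_range, Finset.card_eq_one]
    refine ⟨n, ?_⟩
    ext k
    rw [Finset.mem_filter, Finset.mem_range, Finset.mem_singleton, ← hnf, ← Equiv.Perm.coe_pow]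
    constructor
    · rintro ⟨hk, hkn⟩
      have := ((C.isCycleOn (G.tail e)).pow_apply_eq_pow_apply (a := C.next e)
        (by simp [C.tail_next])).1 hkn
      exact Nat.ModEq.eq_of_lt_of_lt this hk hn
    · rintro rfl
      exact ⟨hn, rfl⟩

/-- Starting from `e`, each full turn hits `e` only at its last step, so an incomplete turn misses
it. -/
theorem hits_self_lt (C : G.CyclicOrdering) (e : E) {q n : ℕ}
    (h : n < q * G.outDegree (G.tail e)) : C.hits e e n < q := by
  classical
  obtain ⟨m, hm⟩ : ∃ m, q * G.outDegree (G.tail e) = m + 1 := ⟨_, (Nat.succ_pred (by omega)).symm⟩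
  have h1 := C.hits_mul_outDegree (e := e) rfl q
  have h2 := C.hits_mono e e (show n ≤ m by omega)
  rw [hm, hits, Nat.count_succ, if_pos, ← hits] at h1
  · omega
  · rw [← hm]
    exact (C.iterate_next_eq_self_iff e _).2 (Dvd.intro_left _ rfl)

end CyclicOrdering

end Cyclic

theorem balanced_natCast [DecidableEq V] [Fintype E] {k : V → ℕ} :
    (G.Balanced fun v => (k v : ℝ)) ↔
      ∀ u, ∑ f with G.head f = u, k (G.tail f) = k u * G.outDegree u := by
  simp only [Balanced]
  exact_mod_cast Iff.rfl

/-! ### Conservation of the chip and return of the state -/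

section Dynamics

variable [DecidableEq V] (C : G.CyclicOrdering) (c : G.State)

theorem turn_edge_self (ρ : G.RotorConfig) (v : V) :
    (turn C ρ v).edge v = C.next (ρ.edge v) :=
  Function.update_self ..

theorem turn_edge_of_ne (ρ : G.RotorConfig) {u v : V} (h : u ≠ v) :
    (turn C ρ v).edge u = ρ.edge u :=
  Function.update_of_ne h ..

/-- The number of times that the chip leaves `u` during the first `t` steps. -/
def visits (u : V) (t : ℕ) : ℕ := Nat.count (fun i => rotorWalk C c i = u) t

/-- The rotor configuration after `t` steps. -/
def rotorAt (t : ℕ) : G.RotorConfig := ((rotorRouter C)^[t] c).2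

@[simp]
theorem visits_zero (u : V) : visits C c u 0 = 0 := Nat.count_zero _

theorem visits_succ (u : V) (t : ℕ) :
    visits C c u (t + 1) = visits C c u t + if rotorWalk C c t = u then 1 else 0 :=
  Nat.count_succ _ _

theorem iterate_rotorRouter (t : ℕ) :
    (rotorRouter C)^[t] c = (rotorWalk C c t, rotorAt C c t) := rfl

theorem rotorAt_succ (t : ℕ) :
    rotorAt C c (t + 1) = turn C (rotorAt C c t) (rotorWalk C c t) := by
  rw [rotorAt, Function.iterate_succ_apply']
  rfl

theorem rotorWalk_succ (t : ℕ) :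
    rotorWalk C c (t + 1) = G.head ((rotorAt C c (t + 1)).edge (rotorWalk C c t)) := by
  rw [rotorAt_succ, rotorWalk, Function.iterate_succ_apply']
  rfl

theorem edge_rotorAt (u : V) (t : ℕ) :
    (rotorAt C c t).edge u = C.next^[visits C c u t] (c.2.edge u) := by
  induction t with
  | zero => simp [visits, rotorAt]
  | succ t ih =>
    rw [rotorAt_succ, visits_succ]
    by_cases h : rotorWalk C c t = u
    · rw [if_pos h, Function.iterate_succ_apply', ← ih, h, turn_edge_self]
    · rw [if_neg h, add_zero, turn_edge_of_ne C _ (Ne.symm h), ih]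

theorem sum_visits [Fintype V] (t : ℕ) : ∑ u, visits C c u t = t := by
  induction t with
  | zero => simp [visits]
  | succ t ih => simp [visits_succ, Finset.sum_add_distrib, ih]

/-- The number of times that the chip moves along `f` during the first `t` steps. -/
noncomputable def traversals (f : E) (t : ℕ) : ℕ :=
  C.hits (c.2.edge (G.tail f)) f (visits C c (G.tail f) t)

open Classical in
theorem traversals_succ (f : E) (t : ℕ) :
    traversals C c f (t + 1) = traversals C c f t +
      if (rotorAt C c (t + 1)).edge (rotorWalk C c t) = f then 1 else 0 := by
  rw [traversals, visits_succ, traversals]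
  by_cases h : rotorWalk C c t = G.tail f
  · rw [if_pos h, CyclicOrdering.hits, Nat.count_succ, edge_rotorAt, visits_succ, h, if_pos rfl]
    rfl
  · rw [if_neg h, add_zero, if_neg, add_zero]
    intro h'
    apply h
    rw [← h', RotorConfig.tail_edge]

/-- Conservation at `u`: arrivals plus initial presence equal departures plus current presence. -/
theorem sum_traversals_add [Fintype E] (u : V) (t : ℕ) :
    (∑ f with G.head f = u, traversals C c f t) + (if c.1 = u then 1 else 0) =
      visits C c u t + if rotorWalk C c t = u then 1 else 0 := by
  classical
  induction t with
  | zero =>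
    simp [traversals, CyclicOrdering.hits, rotorWalk]
    rfl
  | succ t ih =>
    rw [visits_succ, ← ih]
    simp only [traversals_succ, Finset.sum_add_distrib, Finset.sum_ite_eq, Finset.mem_filter,
      Finset.mem_univ, true_and, rotorWalk_succ C c t]
    ring

/-- A path stopped on its first arrival at `v` does not use the rotor at `v`. -/
theorem exists_iterate_succ_turn (ρ : G.RotorConfig) {u v : V} (h : ∃ n, ρ.succ^[n] u = v) :
    ∃ n, (turn C ρ v).succ^[n] u = v := by
  obtain ⟨n, hn⟩ := h
  induction n generalizing u with
  | zero => exact ⟨0, hn⟩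
  | succ n ih =>
    by_cases hu : u = v
    · exact ⟨0, hu⟩
    · obtain ⟨m, hm⟩ := ih hn
      refine ⟨m + 1, ?_⟩
      rw [Function.iterate_succ_apply, RotorConfig.succ, turn_edge_of_ne C ρ hu]
      exact hm

/-- The rotor at a visited vertex records the last exit, and following last exits leads to the chip.
-/
theorem exists_iterate_succ_of_visits_pos {u : V} {t : ℕ} (h : 0 < visits C c u t) :
    ∃ n, (rotorAt C c t).succ^[n] u = rotorWalk C c t := by
  induction t with
  | zero => simp [visits] at h
  | succ t ih =>
    have key : ∃ n, (rotorAt C c (t + 1)).succ^[n] u = rotorWalk C c t := by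
      by_cases hu : rotorWalk C c t = u
      · exact ⟨0, hu.symm⟩
      · rw [visits_succ, if_neg hu, add_zero] at h
        rw [rotorAt_succ]
        exact exists_iterate_succ_turn C _ (ih h)
    obtain ⟨n, hn⟩ := key
    refine ⟨n + 1, ?_⟩
    rw [Function.iterate_succ_apply', hn, rotorWalk_succ]
    rfl

variable {C c} [Fintype E]

/-- In a recurrent state, every rotor makes the same number of full turns during each period, and
these numbers are balanced. -/
theorem exists_balanced_of_iterate_eq (hG : G.StronglyConnected) {n : ℕ} (hn : 0 < n)
    (h : (rotorRouter C)^[n] c = c) :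
    ∃ k : V → ℕ, (∀ v, visits C c v n = k v * G.outDegree v) ∧ (∀ v, 0 < k v) ∧
      G.Balanced fun v => (k v : ℝ) := by
  have hdvd : ∀ v, ∃ k, visits C c v n = k * G.outDegree v := fun v => by
    have h1 := edge_rotorAt C c v n
    rw [rotorAt, h, eq_comm, C.iterate_next_eq_self_iff, c.2.tail_edge] at h1
    obtain ⟨k, hk⟩ := h1
    exact ⟨k, hk.trans (mul_comm _ _)⟩
  choose k hk using hdvd
  have htrav : ∀ f, traversals C c f n = k (G.tail f) := fun f => by
    have h1 := C.hits_mul_outDegree (e := c.2.edge (G.tail f)) (f := f) (c.2.tail_edge _)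
      (k (G.tail f))
    rwa [c.2.tail_edge, ← hk] at h1
  have hbal : G.Balanced fun v => (k v : ℝ) := balanced_natCast.2 fun u => by
    have h1 := sum_traversals_add C c u n
    rw [rotorWalk, h, add_left_inj] at h1
    simp only [htrav, hk] at h1
    exact h1
  refine ⟨k, hk, fun v => ?_, hbal⟩
  -- The first step already leaves `c.1`; balance then spreads positivity.
  have hpos : 0 < k c.1 := by
    have h1 : visits C c c.1 1 ≤ visits C c c.1 n := Nat.count_monotone _ hn
    rw [visits_succ, if_pos (by rfl), hk] at h1
    exact Nat.pos_of_mul_pos_right (by omega : 0 < k c.1 * G.outDegree c.1)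
  exact_mod_cast hbal.pos hG (fun v => Nat.cast_nonneg _) (Nat.cast_pos.2 hpos) v

theorem IsRecurrent.leadsTo (hG : G.StronglyConnected) (hsink : ∀ v, ¬ G.IsSink v)
    (h : IsRecurrent C c) : c.2.LeadsTo c.1 := by
  obtain ⟨n, hn, hnc⟩ := h
  obtain ⟨k, hk, hpos, -⟩ := exists_balanced_of_iterate_eq hG hn hnc
  intro u
  have := exists_iterate_succ_of_visits_pos C c (u := u) (t := n)
    (by rw [hk]; exact Nat.mul_pos (hpos u) (Nat.pos_of_ne_zero (hsink u)))
  rwa [rotorAt, rotorWalk, hnc] at this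

/-- If all rotors lead to the chip, then the chip returns with the initial rotor configuration as
soon as the rotors have made the numbers of full turns given by a balanced vector. -/
theorem iterate_eq_of_balanced [Fintype V] (hlead : c.2.LeadsTo c.1) {p : V → ℕ}
    (hp : G.Balanced fun v => (p v : ℝ)) :
    (rotorRouter C)^[∑ v, p v * G.outDegree v] c = c := by
  have hp' : ∀ u, ∑ f with G.head f = u, p (G.tail f) = p u * G.outDegree u :=
    balanced_natCast.1 hp
  -- Step `t` is the first to exceed a quota `p v * outDegree v`; it exists because the quotas have
  -- a finite sum.
  obtain ⟨t, hle, u, hu⟩ : ∃ t, (∀ v, visits C c v t ≤ p v * G.outDegree v) ∧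
      ∃ u, p u * G.outDegree u < visits C c u (t + 1) := by
    by_contra! hcon
    have hall : ∀ t v, visits C c v t ≤ p v * G.outDegree v := fun t => by
      induction t with
      | zero => simp [visits]
      | succ t ih => exact hcon t ih
    have h1 := sum_visits C c (∑ v, p v * G.outDegree v + 1)
    have h2 := Finset.sum_le_sum fun v (_ : v ∈ Finset.univ) =>
      hall (∑ v, p v * G.outDegree v + 1) v
    omega
  have htrav : ∀ f, traversals C c f t ≤ p (G.tail f) := fun f => by
    have h1 := C.hits_mul_outDegree (e := c.2.edge (G.tail f)) (f := f) (c.2.tail_edge _)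
      (p (G.tail f))
    rw [c.2.tail_edge] at h1
    exact (C.hits_mono _ _ (hle (G.tail f))).trans h1.le
  have hut : rotorWalk C c t = u ∧ visits C c u t = p u * G.outDegree u := by
    have h1 := hle u
    rw [visits_succ] at hu
    split_ifs at hu with h2
    · exact ⟨h2, by omega⟩
    · omega
  -- Otherwise `u` would have received one chip more than the quotas of its in-neighbours allow.
  have hcu : c.1 = u := by
    have h1 := sum_traversals_add C c u t
    have h2 := Finset.sum_le_sum fun f (_ : f ∈ Finset.univ.filter fun f => G.head f = u) => htrav f
    rw [hp'] at h2
    rw [if_pos hut.1] at h1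
    split_ifs at h1 with h3
    · exact h3
    · omega
  -- Induction backwards along the initial rotors. If the successor of `v` is full, all edges into
  -- it are saturated, among them the initial rotor of `v`, which is the last edge of each full
  -- turn; so `v` is full.
  have hfull : ∀ v, visits C c v t = p v * G.outDegree v := by
    intro v
    obtain ⟨n, hn⟩ := hlead v
    induction n generalizing v with
    | zero => rw [show v = u from hn.trans hcu, hut.2]
    | succ n ih =>
      have h1 := ih _ hn
      refine (hle v).antisymm (not_lt.1 fun hlt => ?_)
      have h2 := sum_traversals_add C c (c.2.succ v) t
      rw [hut.1, hcu, add_left_inj, h1, ← hp'] at h2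
      refine (Finset.sum_lt_sum (fun f _ => htrav f) ⟨c.2.edge v, ?_, ?_⟩).ne h2
      · exact Finset.mem_filter.2 ⟨Finset.mem_univ _, rfl⟩
      · rw [traversals, c.2.tail_edge]
        exact C.hits_self_lt _ (by rwa [c.2.tail_edge])
  have ht : t = ∑ v, p v * G.outDegree v := by
    rw [← sum_visits C c t]
    exact Finset.sum_congr rfl fun v _ => hfull v
  rw [← ht, iterate_rotorRouter, hut.1, ← hcu]
  refine Prod.ext rfl (RotorConfig.edge_injective (funext fun v => ?_))
  change (rotorAt C c t).edge v = _
  rw [edge_rotorAt, C.iterate_next_eq_self_iff, c.2.tail_edge, hfull]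
  exact Dvd.intro_left _ rfl

end Dynamics

/-! ### The minimal period and its visit counts -/

section Periods

variable [DecidableEq V] {C : G.CyclicOrdering} {c : G.State}

theorem rotorWalk_add (m i : ℕ) :
    rotorWalk C c (m + i) = rotorWalk C ((rotorRouter C)^[m] c) i := by
  rw [rotorWalk, rotorWalk, add_comm, Function.iterate_add_apply]

theorem visits_add (v : V) (m t : ℕ) :
    visits C c v (m + t) = visits C c v m + visits C ((rotorRouter C)^[m] c) v t := by
  rw [visits, Nat.count_add]
  simp only [rotorWalk_add]
  rfl

theorem exists_isRecurrent_iterate [Finite V] [Finite E] (C : G.CyclicOrdering) (c : G.State) :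
    ∃ m, IsRecurrent C ((rotorRouter C)^[m] c) := by
  obtain ⟨m, n, hmn, h⟩ := Finite.exists_ne_map_eq_of_infinite fun n => (rotorRouter C)^[n] c
  wlog hlt : m < n generalizing m n
  · exact this n m hmn.symm h.symm (by omega)
  refine ⟨m, n - m, by omega, ?_⟩
  rw [← Function.iterate_add_apply, Nat.sub_add_cancel hlt.le]
  exact h.symm

theorem IsRecurrent.minimalPeriod_pos (h : IsRecurrent C c) :
    0 < Function.minimalPeriod (rotorRouter C) c :=
  Function.minimalPeriod_pos_of_mem_periodicPts h

theorem IsRecurrent.ncard_orbit (h : IsRecurrent C c) (v : V) :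
    Set.ncard {d : G.State | d ∈ orbit C c ∧ d.1 = v} =
      visits C c v (Function.minimalPeriod (rotorRouter C) c) := by
  rw [visits, Nat.count_eq_card_filter_range, ← Set.ncard_coe_finset]
  symm
  refine Set.ncard_congr (fun i _ => (rotorRouter C)^[i] c) ?_ ?_ ?_
  · intro i hi
    exact ⟨⟨i, rfl⟩, (Finset.mem_filter.1 hi).2⟩
  · intro i j hi hj hij
    exact (Function.iterate_eq_iterate_iff_of_lt_minimalPeriod
      (Finset.mem_range.1 (Finset.mem_filter.1 hi).1)
      (Finset.mem_range.1 (Finset.mem_filter.1 hj).1)).1 hij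
  · rintro d ⟨⟨n, rfl⟩, hn⟩
    refine ⟨n % Function.minimalPeriod (rotorRouter C) c, ?_,
      Function.iterate_mod_minimalPeriod_eq⟩
    rw [Finset.mem_coe, Finset.mem_filter, Finset.mem_range, rotorWalk,
      Function.iterate_mod_minimalPeriod_eq]
    exact ⟨Nat.mod_lt _ h.minimalPeriod_pos, hn⟩

variable [Fintype V] [Fintype E]

theorem gcd_eq_one_of_visits_minimalPeriod (h : IsRecurrent C c) (hlead : c.2.LeadsTo c.1)
    {k : V → ℕ}
    (hk : ∀ v, visits C c v (Function.minimalPeriod (rotorRouter C) c) = k v * G.outDegree v)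
    (hbal : G.Balanced fun v => (k v : ℝ)) : Finset.univ.gcd k = 1 := by
  obtain ⟨p, hp, -⟩ := Finset.extract_gcd k (Finset.univ_nonempty_iff.2 ⟨c.1⟩)
  set g := Finset.univ.gcd k
  set P := Function.minimalPeriod (rotorRouter C) c
  have hP : P = g * ∑ v, p v * G.outDegree v := by
    rw [← sum_visits C c P, Finset.mul_sum]
    refine Finset.sum_congr rfl fun v hv => ?_
    rw [hk, hp v hv, mul_assoc]
  have hPpos : 0 < P := h.minimalPeriod_pos
  have hg : 0 < g := Nat.pos_of_ne_zero fun h0 => by simp [h0] at hP; omega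
  have hpbal : G.Balanced fun v => (p v : ℝ) := balanced_natCast.2 fun u => by
    have h1 := balanced_natCast.1 hbal u
    simp only [hp _ (Finset.mem_univ _), ← Finset.mul_sum, mul_assoc] at h1
    exact Nat.eq_of_mul_eq_mul_left hg h1
  -- The reduced vector `p` is balanced too, so the state returns after `P / g` steps.
  obtain ⟨j, hj⟩ : P ∣ ∑ v, p v * G.outDegree v :=
    (Function.isPeriodicPt_iff_minimalPeriod_dvd).1 (iterate_eq_of_balanced hlead hpbal)
  rw [hj, mul_left_comm] at hP
  exact Nat.eq_one_of_mul_eq_one_right (Nat.eq_of_mul_eq_mul_left hPpos (by rw [← hP, mul_one]))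

/-- The number of visits to `v` during one period of a recurrent state. -/
theorem IsRecurrent.visits_minimalPeriod (hG : G.StronglyConnected) (hsink : ∀ v, ¬ G.IsSink v)
    (h : IsRecurrent C c) :
    (∀ v, visits C c v (Function.minimalPeriod (rotorRouter C) c) * G.treeGcd =
      G.numSpanningTrees v * G.outDegree v) ∧ 0 < G.treeGcd := by
  have hlead := h.leadsTo hG hsink
  obtain ⟨k, hk, hpos, hbal⟩ := exists_balanced_of_iterate_eq hG h.minimalPeriod_pos
    (Function.iterate_minimalPeriod (f := rotorRouter C) (x := c))
  have hgcd := gcd_eq_one_of_visits_minimalPeriod h hlead hk hbal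
  have : Nonempty V := ⟨c.1⟩
  obtain ⟨a, ha⟩ := G.balanced_numSpanningTrees.exists_eq_smul hG hbal
    fun v => Nat.cast_pos.2 (hpos v)
  have hprop : ∀ u v, G.numSpanningTrees v * k u = k v * G.numSpanningTrees u := fun u v => by
    have h1 : (G.numSpanningTrees v : ℝ) * k u = k v * G.numSpanningTrees u := by
      rw [ha, ha]; ring
    exact_mod_cast h1
  -- Take the gcd over `u` of both sides of `hprop`.
  have hT : ∀ v, G.numSpanningTrees v = k v * G.treeGcd := fun v => by
    have h1 := Finset.gcd_mul_left (s := Finset.univ) (f := k) (a := G.numSpanningTrees v)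
    have h2 := Finset.gcd_mul_left (s := Finset.univ) (f := G.numSpanningTrees) (a := k v)
    simp only [hprop] at h1
    rw [h1, hgcd] at h2
    simpa [treeGcd] using h2
  refine ⟨fun v => by rw [hk, hT]; ring, Nat.pos_of_ne_zero fun h0 => ?_⟩
  have h1 := G.ncard_rotorConfig_leadsTo c.1
  rw [hT, h0, mul_zero, zero_mul, Set.ncard_eq_zero] at h1
  exact Set.eq_empty_iff_forall_notMem.1 h1 c.2 hlead

theorem IsRecurrent.visits_div_minimalPeriod (hG : G.StronglyConnected)
    (hsink : ∀ v, ¬ G.IsSink v) (h : IsRecurrent C c) (v : V) :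
    (visits C c v (Function.minimalPeriod (rotorRouter C) c) : ℝ) /
      Function.minimalPeriod (rotorRouter C) c = G.treeFrequency v := by
  obtain ⟨h1, hM⟩ := h.visits_minimalPeriod hG hsink
  set P := Function.minimalPeriod (rotorRouter C) c
  have h2 : (G.treeGcd : ℝ) ≠ 0 := Nat.cast_ne_zero.2 hM.ne'
  have h3 : ∀ w, (G.numSpanningTrees w : ℝ) * G.outDegree w = visits C c w P * G.treeGcd :=
    fun w => by exact_mod_cast (h1 w).symm
  rw [treeFrequency]
  simp only [h3]
  rw [← Finset.sum_mul, mul_div_mul_right _ _ h2, ← Nat.cast_sum, sum_visits]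

end Periods

/-- After removing the linear drift `t * (a / P)`, what remains is eventually periodic, hence
bounded. -/
theorem tendsto_div_of_add_period {g : ℕ → ℝ} {m P : ℕ} {a : ℝ} (hP : 0 < P)
    (h : ∀ t, m ≤ t → g (t + P) = g t + a) :
    Tendsto (fun t : ℕ => g t / t) atTop (𝓝 (a / P)) := by
  have hP' : (P : ℝ) ≠ 0 := Nat.cast_ne_zero.2 hP.ne'
  set b : ℕ → ℝ := fun t => g t - t * (a / P)
  have hb : ∀ t, m ≤ t → b (t + P) = b t := fun t ht => by
    simp only [b, h t ht, Nat.cast_add]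
    field_simp
    ring
  obtain ⟨K, hK⟩ : ∃ K, ∀ t, |b t| ≤ K := by
    refine ⟨∑ i ∈ Finset.range (m + P), |b i|, fun t => ?_⟩
    induction t using Nat.strong_induction_on with
    | _ t ih =>
      by_cases ht : t < m + P
      · exact Finset.single_le_sum (f := fun i => |b i|) (fun i _ => abs_nonneg _)
          (Finset.mem_range.2 ht)
      · have h1 := hb (t - P) (by omega)
        rw [Nat.sub_add_cancel (by omega)] at h1
        rw [h1]
        exact ih _ (by omega)
  have hlim : Tendsto (fun t : ℕ => b t / t) atTop (𝓝 0) := by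
    refine squeeze_zero_norm (fun t => ?_) (tendsto_const_div_atTop_nhds_zero_nat K)
    rw [norm_div, Real.norm_eq_abs, RCLike.norm_natCast]
    exact div_le_div_of_nonneg_right (hK t) (Nat.cast_nonneg t)
  have h2 := hlim.add_const (a / P)
  rw [zero_add] at h2
  refine h2.congr' ?_
  filter_upwards [eventually_gt_atTop 0] with t ht
  have : (t : ℝ) ≠ 0 := Nat.cast_ne_zero.2 ht.ne'
  simp only [b]
  field_simp
  ring

/-! ### Limit frequencies and the stationary distribution -/

section Limit

variable [DecidableEq V] [Fintype V] [Fintype E]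

theorem tendsto_visits_div (hG : G.StronglyConnected) (hsink : ∀ v, ¬ G.IsSink v)
    (C : G.CyclicOrdering) (c : G.State) (v : V) :
    Tendsto (fun t : ℕ => (visits C c v t : ℝ) / t) atTop (𝓝 (G.treeFrequency v)) := by
  obtain ⟨m, hm⟩ := exists_isRecurrent_iterate C c
  rw [← hm.visits_div_minimalPeriod hG hsink v]
  refine tendsto_div_of_add_period (m := m) hm.minimalPeriod_pos fun t ht => ?_
  obtain ⟨s, rfl⟩ := Nat.exists_eq_add_of_le ht
  set P := Function.minimalPeriod (rotorRouter C) ((rotorRouter C)^[m] c)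
  rw [add_assoc, add_comm s P, visits_add, visits_add v m s, visits_add v P s,
    Function.iterate_minimalPeriod]
  push_cast
  ring

theorem sum_mul_numEdges (z : V → ℝ) (w : V) :
    ∑ u, z u * G.numEdges u w = ∑ f with G.head f = w, z (G.tail f) := by
  rw [← Finset.sum_fiberwise _ G.tail]
  refine Finset.sum_congr rfl fun u _ => ?_
  rw [Finset.sum_congr rfl (g := fun _ => z u) fun f hf => by rw [(Finset.mem_filter.1 hf).2],
    Finset.sum_const, nsmul_eq_mul, mul_comm, Finset.filter_filter, numEdges]
  simp only [and_comm]

theorem vecMul_transitionMatrix_eq_iff (hsink : ∀ v, ¬ G.IsSink v) (π : V → ℝ) :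
    Matrix.vecMul π G.transitionMatrix = π ↔ G.Balanced fun v => π v / G.outDegree v := by
  rw [funext_iff, Balanced]
  refine forall_congr' fun w => ?_
  have h : (G.outDegree w : ℝ) ≠ 0 := Nat.cast_ne_zero.2 (hsink w)
  rw [← sum_mul_numEdges (fun v => π v / G.outDegree v), div_mul_cancel₀ _ h]
  simp only [Matrix.vecMul, dotProduct, transitionMatrix, Matrix.of_apply, mul_div_assoc',
    div_mul_eq_mul_div]

theorem isStationaryDistribution_iff [Nonempty V] (hG : G.StronglyConnected)
    (hsink : ∀ v, ¬ G.IsSink v) (hT : ∀ v, 0 < G.numSpanningTrees v) (π : V → ℝ) :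
    G.IsStationaryDistribution π ↔ π = G.treeFrequency := by
  have hdeg : ∀ v, (0 : ℝ) < G.outDegree v := fun v =>
    Nat.cast_pos.2 (Nat.pos_of_ne_zero (hsink v))
  have hT' : ∀ v, (0 : ℝ) < G.numSpanningTrees v := fun v => Nat.cast_pos.2 (hT v)
  have hS : (0 : ℝ) < ∑ w, (G.numSpanningTrees w : ℝ) * G.outDegree w :=
    Finset.sum_pos (fun w _ => mul_pos (hT' w) (hdeg w)) Finset.univ_nonempty
  rw [IsStationaryDistribution, vecMul_transitionMatrix_eq_iff hsink]
  constructor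
  · rintro ⟨⟨-, hsum⟩, hbal⟩
    obtain ⟨a, ha⟩ := hbal.exists_eq_smul hG G.balanced_numSpanningTrees hT'
    have hπ : ∀ v, π v = a * (G.numSpanningTrees v * G.outDegree v) := fun v => by
      rw [← mul_assoc, ← ha, div_mul_cancel₀ _ (hdeg v).ne']
    simp only [hπ, ← Finset.mul_sum] at hsum
    funext v
    rw [hπ, treeFrequency, eq_div_iff hS.ne', mul_right_comm, hsum, one_mul]
  · rintro rfl
    refine ⟨⟨fun v => div_nonneg (mul_pos (hT' v) (hdeg v)).le hS.le, ?_⟩, fun u => ?_⟩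
    · simp only [treeFrequency]
      rw [← Finset.sum_div, div_self hS.ne']
    · have h1 : ∀ v, G.treeFrequency v / G.outDegree v =
          G.numSpanningTrees v / ∑ w, (G.numSpanningTrees w : ℝ) * G.outDegree w := fun v => by
        rw [treeFrequency, div_right_comm, mul_div_cancel_right₀ _ (hdeg v).ne']
      simp only [h1]
      rw [← Finset.sum_div, G.balanced_numSpanningTrees u, div_mul_eq_mul_div]

/-- The rotors of a recurrent state supply a tree rooted at the chip; balance carries positivity to
every root. -/
theorem numSpanningTrees_pos (hG : G.StronglyConnected) (hsink : ∀ v, ¬ G.IsSink v)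
    {C : G.CyclicOrdering} {c : G.State} (h : IsRecurrent C c) (v : V) :
    0 < G.numSpanningTrees v := by
  have h1 : 0 < G.numSpanningTrees c.1 * G.outDegree c.1 := by
    rw [← ncard_rotorConfig_leadsTo, Set.ncard_pos]
    exact ⟨c.2, h.leadsTo hG hsink⟩
  exact_mod_cast G.balanced_numSpanningTrees.pos hG (fun _ => Nat.cast_nonneg _)
    (Nat.cast_pos.2 (Nat.pos_of_mul_pos_right h1)) v

end Limit

theorem nonempty_state [DecidableEq V] [Fintype E] [Nonempty V]
    (hsink : ∀ v, ¬ G.IsSink v) : Nonempty G.State := by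
  have h : ∀ v, ∃ e, G.tail e = v := fun v => by
    obtain ⟨e, he⟩ := Finset.card_ne_zero.1 (hsink v)
    exact ⟨e, (Finset.mem_filter.1 he).2⟩
  choose r hr using h
  exact ⟨Classical.arbitrary V, r, hr⟩

end MultiDigraph

theorem mainTheorem3 {V E : Type*} [Fintype V] [DecidableEq V] [Nonempty V] [Fintype E]
    (G : MultiDigraph V E) (hG : G.StronglyConnected) (hsink : ∀ v : V, ¬ G.IsSink v)
    (C : G.CyclicOrdering) :
    (∀ c : G.State, MultiDigraph.IsRecurrent C c → ∀ v : V,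
      (Set.ncard {d : G.State | d ∈ MultiDigraph.orbit C c ∧ d.1 = v} : ℝ) =
        ((G.numSpanningTrees v : ℝ) * (G.outDegree v : ℝ)) / (G.treeGcd : ℝ)) ∧
    (∀ c : G.State, ∀ v : V,
      Tendsto
        (fun t : ℕ =>
          (∑ i ∈ Finset.range t, if MultiDigraph.rotorWalk C c i = v then (1 : ℝ) else 0) /
            (t : ℝ))
        atTop (𝓝 (G.treeFrequency v))) ∧
    (∀ π : V → ℝ, G.IsStationaryDistribution π ↔ π = G.treeFrequency) := by
  refine ⟨fun c hc v => ?_, fun c v => ?_, fun π => ?_⟩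
  · obtain ⟨h, hM⟩ := hc.visits_minimalPeriod hG hsink
    rw [hc.ncard_orbit, eq_div_iff (Nat.cast_ne_zero.2 hM.ne')]
    exact_mod_cast h v
  · refine (MultiDigraph.tendsto_visits_div hG hsink C c v).congr fun t => ?_
    rw [MultiDigraph.visits, Nat.count_eq_card_filter_range, Finset.sum_boole]
  -- The rotor walk enters here only to show that spanning trees exist.
  · obtain ⟨c⟩ := MultiDigraph.nonempty_state hsink
    obtain ⟨m, hm⟩ := MultiDigraph.exists_isRecurrent_iterate C c
    exact MultiDigraph.isStationaryDistribution_iff hG hsink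
      (MultiDigraph.numSpanningTrees_pos hG hsink hm) π
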